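/- Let $d,N,K\ge 1$ and $T\ge d^2$ be integers. Let $\mathcal A_n=\{a_n^1,\dots,a_n^K\}$, $n\in[N]$, be sets of vectors in the closed Euclidean unit ball of $\mathbb R^d$, let $\theta^\star$ lie in this ball, and suppose that $\mathcal B=\{a_n^i-a_n^j : n\in[N],\ i,j\in[K]\}$ spans $\mathbb R^d$. For a probability distribution $\pi$ on $\mathcal B$ put $V(\pi)=\sum_{b\in\mathcal B}\pi(b)\,bb^{\top}$ and $g(\pi)=\max_{b\in\mathcal B} b^{\top}V(\pi)^{-1}b$ (with $g(\pi)=\infty$ if $V(\pi)$ is singular). Let $\pi^\star$ minimize $g$ (an optimal design), and let $\hat\pi$ be a $3/2$-approximation of it, that is, $g(\hat\pi)\le\frac32\,g(\pi^\star)$. Select a finite sequence of pairs $(a_s,a'_s)_{s\in[m]}$, each consisting of two elements of one and the same $\mathcal A_n$, such that every $b\in\mathcal B$ is equal to $b_s:=a_s-a'_s$ for exactly $\lceil T\hat\pi(b)\rceil$ indices $s$ (so $m\ge T$). Let the labels $Y_s\in\{0,1\}$ be independent with $\mathbb P(Y_s=1)=\sigma(\langle\theta^\star,b_s\rangle)$,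 where $\sigma(x)=1/(1+e^{-x})$. With $\lambda=1/d$, let $\hat\theta$ maximize over $\mathbb R^d$ the regularized log-likelihood $$\sum_s \big[Y_s\log\sigma(\langle\theta,b_s\rangle)+(1-Y_s)\log\sigma(-\langle\theta,b_s\rangle)\big]-\tfrac{\lambda}{2}\|\theta\|_2^2,$$ let $H(\theta)=\lambda\theta+\sum_s\sigma(\langle\theta,b_s\rangle)b_s$ and $V=\lambda I+\sum_s b_sb_s^{\top}$, and let $\hat\theta^P$ minimize $\theta\mapsto\|H(\theta)-H(\hat\theta)\|_{V^{-1}}$ over the closed unit ball, where $\|x\|_{V^{-1}}=\sqrt{x^{\top}V^{-1}x}$. Let $\hat a_n\in\operatorname{argmax}_{a\in\mathcal A_n}\langle\hat\theta^P,a\rangle$ (any maximizers, chosen measurably), and let $R=\max_{n\in[N]}\max_{a\in\mathcal A_n}\langle\theta^\star,a-\hat a_n\rangle$ be the simple regret. Then for every $\delta\in(0,1)$, with probability at least $1-\delta$, $$R\le 30\sqrt{\frac dT}\left[\sqrt{2\log\frac1\delta+d\log\frac{1+4T}{d^{1-1/d}}}+\frac1{\sqrt d}\right],$$ and consequently (take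 $\delta=d^{1-1/d}/(4T+1)$) $$\mathbb E[R]\le 30\,\frac{d+2}{\sqrt T}\sqrt{\log\frac{4T+1}{d^{1-1/d}}}+\frac{31}{\sqrt T}.$$ -/

import Mathlib

open MeasureTheory ProbabilityTheory
open scoped Matrix

noncomputable section

namespace ODPO

/-- The embedding space `ℝᵈ` with its Euclidean structure. -/
abbrev Vec (d : ℕ) := EuclideanSpace ℝ (Fin d)

/-- The rank-one matrix `b bᵀ`. -/
def outer {d : ℕ} (b : Vec d) : Matrix (Fin d) (Fin d) ℝ :=
  Matrix.vecMulVec b.ofLp b.ofLp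

/-- The square of the weighted norm: `‖x‖²_A = xᵀ A x`. -/
def sqNormW {d : ℕ} (A : Matrix (Fin d) (Fin d) ℝ) (x : Vec d) : ℝ :=
  x.ofLp ⬝ᵥ (A *ᵥ x.ofLp)

/-- The weighted norm `‖x‖_A = √(xᵀ A x)`. -/
def normW {d : ℕ} (A : Matrix (Fin d) (Fin d) ℝ) (x : Vec d) : ℝ :=
  Real.sqrt (sqNormW A x)

section Actions

variable {d N K : ℕ}

open Classical in
/-- The set `𝓑 = ⋃ₙ (𝓐ₙ - 𝓐ₙ)` of differences of two actions of the same context, where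
`𝓐ₙ = {a n k : k}`. -/
def diffSet (a : Fin N → Fin K → Vec d) : Finset (Vec d) :=
  Finset.univ.image fun q : Fin N × Fin K × Fin K => a q.1 q.2.1 - a q.1 q.2.2

/-- The simple regret `max_n max_{a ∈ 𝓐ₙ} ⟨θ, a - âₙ⟩` of the choices `âₙ`. -/
def simpleRegret (a : Fin N → Fin K → Vec d) (θ : Vec d) (ahat : Fin N → Vec d) : ℝ :=
  ⨆ n : Fin N, ⨆ k : Fin K, inner ℝ θ (a n k - ahat n)

end Actions

section Design

variable {d : ℕ}

/-- The design matrix `V(π) = ∑_{b ∈ 𝓑} π(b) b bᵀ`. -/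
def designMatrix (B : Finset (Vec d)) (π : B → ℝ) : Matrix (Fin d) (Fin d) ℝ :=
  ∑ b : B, π b • outer (b : Vec d)

/-- A probability distribution over `𝓑` whose design matrix is invertible, so that `g(π)` is
finite. -/
def IsRegularDesign (B : Finset (Vec d)) (π : B → ℝ) : Prop :=
  π ∈ stdSimplex ℝ B ∧ IsUnit (designMatrix B π).det

/-- `g(π) = max_{b ∈ 𝓑} ‖b‖²_{V(π)⁻¹}`; only used at designs with invertible `V(π)`
(elsewhere `g` counts as infinite). -/
def gValue (B : Finset (Vec d)) (π : B → ℝ) : ℝ :=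
  ⨆ b : B, sqNormW (designMatrix B π)⁻¹ (b : Vec d)

/-- An optimal design: a minimizer of `g`. -/
def IsOptimalDesign (B : Finset (Vec d)) (π : B → ℝ) : Prop :=
  IsRegularDesign B π ∧ ∀ ρ : B → ℝ, IsRegularDesign B ρ → gValue B π ≤ gValue B ρ

/-- `π` is a `c`-approximation of the optimal design `πstar`: `g(π) ≤ c g(πstar)`. -/
def IsApproxOfDesign (B : Finset (Vec d)) (c : ℝ) (πstar π : B → ℝ) : Prop :=
  IsRegularDesign B π ∧ gValue B π ≤ c * gValue B πstar

end Design

section Estimation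

variable {d m : ℕ}

/-- The regularized log-likelihood of `θ`, for duels with differences `b s` between the two
competitors; `y s = true` means that the first competitor wins. -/
def logLik (lam : ℝ) (b : Fin m → Vec d) (y : Fin m → Bool) (θ : Vec d) : ℝ :=
  (∑ s, if y s = true then Real.log (Real.sigmoid (inner ℝ θ (b s)))
    else Real.log (Real.sigmoid (-inner ℝ θ (b s)))) - lam * ‖θ‖ ^ 2 / 2

/-- `H(θ) = λ θ + ∑ₛ σ(⟨θ, bₛ⟩) bₛ`. -/
def Hmap (lam : ℝ) (b : Fin m → Vec d) (θ : Vec d) : Vec d :=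
  lam • θ + ∑ s, Real.sigmoid (inner ℝ θ (b s)) • b s

/-- The regularized design matrix of the collected samples, `V = λ I + ∑ₛ bₛ bₛᵀ`. -/
def sampleMatrix (lam : ℝ) (b : Fin m → Vec d) : Matrix (Fin d) (Fin d) ℝ :=
  lam • (1 : Matrix (Fin d) (Fin d) ℝ) + ∑ s, outer (b s)

/-- `θhat` maximizes the regularized log-likelihood over `ℝᵈ`. -/
def IsMLE (lam : ℝ) (b : Fin m → Vec d) (y : Fin m → Bool) (θhat : Vec d) : Prop :=
  IsMaxOn (logLik lam b y) Set.univ θhat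

/-- `θP` minimizes `θ ↦ ‖H(θ) - H(θhat)‖_{V⁻¹}` over the unit ball. -/
def IsProjectedMLE (lam : ℝ) (b : Fin m → Vec d) (θhat θP : Vec d) : Prop :=
  θP ∈ Metric.closedBall (0 : Vec d) 1 ∧
    IsMinOn (fun θ => normW (sampleMatrix lam b)⁻¹ (Hmap lam b θ - Hmap lam b θhat))
      (Metric.closedBall (0 : Vec d) 1) θP

end Estimation

section Algorithm

variable {d N K m : ℕ}

/-- The difference of the two actions in each selected pair; a pair is given by its context `n`
and the indices `i`, `j` of its two actions in `𝓐ₙ`. -/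
def pairDiff (a : Fin N → Fin K → Vec d) (pair : Fin m → Fin N × Fin K × Fin K) (s : Fin m) :
    Vec d :=
  a (pair s).1 (pair s).2.1 - a (pair s).1 (pair s).2.2

open Classical in
/-- The selected data set follows the design `π` with budget `T`: every `b ∈ 𝓑` is the difference
of exactly `⌈T π(b)⌉` selected pairs. -/
def IsSelectedBy (a : Fin N → Fin K → Vec d) (T : ℕ) (π : diffSet a → ℝ)
    (pair : Fin m → Fin N × Fin K × Fin K) : Prop :=
  ∀ b : diffSet a,
    (Finset.univ.filter fun s => pairDiff a pair s = (b : Vec d)).card = ⌈(T : ℝ) * π b⌉₊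

/-- The choices `ahat n ∈ argmax_{a ∈ 𝓐ₙ} ⟨θP, a⟩`, where `θP` is a projected maximum likelihood
estimator computed from the labels `y` of the selected pairs. -/
def IsOutput (a : Fin N → Fin K → Vec d) (lam : ℝ) (pair : Fin m → Fin N × Fin K × Fin K)
    (y : Fin m → Bool) (ahat : Fin N → Vec d) : Prop :=
  ∃ θhat θP : Vec d, IsMLE lam (pairDiff a pair) y θhat ∧
    IsProjectedMLE lam (pairDiff a pair) θhat θP ∧
    ∀ n, ahat n ∈ Set.range (a n) ∧ ∀ k, (inner ℝ θP (a n k) : ℝ) ≤ inner ℝ θP (ahat n)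

/-- The labels are independent and the first action of the pair `s` wins with probability
`σ(⟨θstar, b s⟩)`. -/
def IsPreferenceFeedback {Ω : Type*} [MeasurableSpace Ω] (μ : Measure Ω) (θstar : Vec d)
    (b : Fin m → Vec d) (Y : Fin m → Ω → Bool) : Prop :=
  (∀ s, Measurable (Y s)) ∧ iIndepFun Y μ ∧
    ∀ s, μ.real {ω | Y s ω = true} = Real.sigmoid (inner ℝ θstar (b s))

end Algorithm

end ODPO

end

namespace ODPO

/-! ### Weighted norms, duality and rank-one updates -/

section LinearAlgebra

variable {d : ℕ}

/-! Since each choice maximizes the score under `θP`, the regret against an action of the same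
context is at most `⟨θstar - θP, b⟩` with `b ∈ 𝓑`. By Cauchy–Schwarz this is at most `‖θstar - θP‖_V
‖b‖_{V⁻¹}` (`IsOutput.simpleRegret_le_noise`), and the two factors are bounded separately.

Design: rounding up gives `V ≥ T V(πhat)`, so `‖b‖²_{V⁻¹} ≤ g(πhat) / T`. Half of Kiefer–Wolfowitz,
by perturbing a maximizer of the determinant, gives `g(πstar) ≤ d`, hence `‖b‖²_{V⁻¹} ≤ 3d / (2T)`.

Estimation: on the unit ball all scores lie in `[-2, 2]`, where `σ' ≥ 1/10`, so `H` expands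
distances by `1/10` from the `V`-norm to the `V⁻¹`-norm. Projection costs a factor 2, and the
first-order condition turns `H(θstar) - H(θhat)` into `λ θstar` minus the centred label noise.

Noise: `V` is deterministic, so the whitened noise is a sub-Gaussian vector `W`. Gaussian
linearization gives `E exp ‖W‖² ≤ 2^(d/2)`, and Markov's inequality gives the tail. The bound on the
expectation combines the tail at one level with `R ≤ 2`. -/

lemma sqNormW_outer (b x : Vec d) : sqNormW (outer b) x = (inner ℝ x b : ℝ) ^ 2 := by
  simp only [sqNormW, outer, Matrix.vecMulVec_mulVec, EuclideanSpace.inner_eq_star_dotProduct,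
    star_trivial]
  simp [dotProduct_comm b.ofLp x.ofLp, sq]

lemma sqNormW_add (A A' : Matrix (Fin d) (Fin d) ℝ) (x : Vec d) :
    sqNormW (A + A') x = sqNormW A x + sqNormW A' x := by
  simp [sqNormW, Matrix.add_mulVec, dotProduct_add]

lemma sqNormW_smul (c : ℝ) (A : Matrix (Fin d) (Fin d) ℝ) (x : Vec d) :
    sqNormW (c • A) x = c * sqNormW A x := by
  simp [sqNormW, Matrix.smul_mulVec, dotProduct_smul]

lemma sqNormW_sum {ι : Type*} (s : Finset ι) (A : ι → Matrix (Fin d) (Fin d) ℝ) (x : Vec d) :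
    sqNormW (∑ i ∈ s, A i) x = ∑ i ∈ s, sqNormW (A i) x := by
  simp [sqNormW, Matrix.sum_mulVec, dotProduct_sum]

lemma sqNormW_one (x : Vec d) : sqNormW 1 x = ‖x‖ ^ 2 := by
  rw [← real_inner_self_eq_norm_sq, EuclideanSpace.inner_eq_star_dotProduct]
  simp [sqNormW]

lemma posSemidef_outer (b : Vec d) : (outer b).PosSemidef := by
  simpa [outer] using Matrix.posSemidef_vecMulVec_self_star b.ofLp

lemma posDef_of_sqNormW_pos {A : Matrix (Fin d) (Fin d) ℝ} (hA : A.PosSemidef)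
    (h : ∀ x : Vec d, x ≠ 0 → 0 < sqNormW A x) : A.PosDef := by
  refine .of_dotProduct_mulVec_pos hA.1 fun v hv => ?_
  simpa [sqNormW] using h (WithLp.toLp 2 v) (by simpa using hv)

open scoped MatrixOrder in
/-- Whitening: a square root `C` of `V`, its inverse `D`, and the dual square root of `V⁻¹`. -/
lemma exists_whitening {V : Matrix (Fin d) (Fin d) ℝ} (hV : V.PosDef) :
    ∃ C D B : Vec d →ₗ[ℝ] Vec d, (∀ x, ‖C x‖ ^ 2 = sqNormW V x) ∧
      (∀ y, ‖B y‖ ^ 2 = sqNormW V⁻¹ y) ∧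
      (∀ x y, (inner ℝ (C x) (B y) : ℝ) = inner ℝ x y) ∧ ∀ g, C (D g) = g := by
  obtain ⟨M, hM⟩ := CStarAlgebra.nonneg_iff_eq_star_mul_self.mp hV.posSemidef.nonneg
  rw [Matrix.star_eq_conjTranspose, Matrix.conjTranspose_eq_transpose_of_trivial] at hM
  have hdet : IsUnit M.det := by
    have := (Matrix.isUnit_iff_isUnit_det V).mp hV.isUnit
    rw [hM, Matrix.det_mul] at this
    exact isUnit_of_mul_isUnit_right this
  have hdetT : IsUnit Mᵀ.det := by rwa [Matrix.det_transpose]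
  have key : ∀ (A : Matrix (Fin d) (Fin d) ℝ) (x : Vec d),
      ‖Matrix.toEuclideanLin A x‖ ^ 2 = sqNormW (Aᵀ * A) x := by
    intro A x
    rw [← real_inner_self_eq_norm_sq, EuclideanSpace.inner_eq_star_dotProduct]
    simp [sqNormW, ← Matrix.mulVec_mulVec, Matrix.dotProduct_mulVec, Matrix.vecMul_transpose]
  -- With `V = MᵀM`, the choice `B = (Mᵀ)⁻¹` gives `BᵀB = V⁻¹` and `MᵀB = 1`.
  refine ⟨Matrix.toEuclideanLin M, Matrix.toEuclideanLin M⁻¹, Matrix.toEuclideanLin (Mᵀ)⁻¹,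
    fun x => ?_, fun y => ?_, fun x y => ?_, fun g => ?_⟩
  · rw [key, ← hM]
  · rw [key, hM, Matrix.mul_inv_rev, Matrix.transpose_nonsing_inv, Matrix.transpose_transpose]
  · rw [EuclideanSpace.inner_eq_star_dotProduct, EuclideanSpace.inner_eq_star_dotProduct]
    simp only [Matrix.ofLp_toLpLin, Matrix.toLin'_apply, star_trivial]
    rw [Matrix.dotProduct_mulVec, ← Matrix.mulVec_transpose, Matrix.mulVec_mulVec,
      Matrix.mul_nonsing_inv _ hdetT, Matrix.one_mulVec]
  · ext i
    simp only [Matrix.ofLp_toLpLin, Matrix.toLin'_apply]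
    rw [Matrix.mulVec_mulVec, Matrix.mul_nonsing_inv _ hdet, Matrix.one_mulVec]

lemma inner_sq_le_sqNormW {V : Matrix (Fin d) (Fin d) ℝ} (hV : V.PosDef) (x y : Vec d) :
    (inner ℝ x y : ℝ) ^ 2 ≤ sqNormW V x * sqNormW V⁻¹ y := by
  obtain ⟨C, D, B, hC, hB, hCB, -⟩ := exists_whitening hV
  rw [← hC, ← hB, ← hCB, ← mul_pow, sq_le_sq, abs_of_nonneg (by positivity : 0 ≤ ‖C x‖ * ‖B y‖)]
  exact abs_real_inner_le_norm _ _

lemma sqNormW_nonneg {V : Matrix (Fin d) (Fin d) ℝ} (hV : V.PosSemidef) (x : Vec d) :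
    0 ≤ sqNormW V x := by
  simpa [sqNormW] using hV.dotProduct_mulVec_nonneg x.ofLp

/-- Inversion reverses the order of the quadratic forms. -/
lemma mul_sqNormW_inv_le {U V : Matrix (Fin d) (Fin d) ℝ} (hU : U.PosDef) (hV : V.PosDef)
    {t : ℝ} (h : ∀ x, t * sqNormW U x ≤ sqNormW V x) (b : Vec d) :
    t * sqNormW V⁻¹ b ≤ sqNormW U⁻¹ b := by
  have hdet : IsUnit V.det := (Matrix.isUnit_iff_isUnit_det V).mp hV.isUnit
  -- The vector `y = V⁻¹ b` is extremal in the duality: `‖y‖²_V = ⟨y, b⟩ = ‖b‖²_{V⁻¹}`.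
  -- Cauchy–Schwarz for `U` at `y` then suffices.
  set y : Vec d := WithLp.toLp 2 (V⁻¹ *ᵥ b.ofLp) with hy
  have h1 : sqNormW V y = sqNormW V⁻¹ b := by
    simp only [sqNormW, hy]
    rw [Matrix.mulVec_mulVec, Matrix.mul_nonsing_inv _ hdet, Matrix.one_mulVec, dotProduct_comm]
  have h2 : (inner ℝ y b : ℝ) = sqNormW V⁻¹ b := by
    simp [sqNormW, hy, EuclideanSpace.inner_eq_star_dotProduct]
  have h3 := inner_sq_le_sqNormW hU y b
  have h4 := h y
  rw [h1] at h4
  rw [h2] at h3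
  have hb := sqNormW_nonneg hU.inv.posSemidef b
  have hq := sqNormW_nonneg hV.inv.posSemidef b
  rcases hq.eq_or_lt with h0 | h0
  · rw [← h0]; simpa using hb
  rcases le_or_gt t 0 with ht | ht
  · nlinarith
  have : t * sqNormW V⁻¹ b ^ 2 ≤ sqNormW V⁻¹ b * sqNormW U⁻¹ b := by
    calc t * sqNormW V⁻¹ b ^ 2 ≤ t * (sqNormW U y * sqNormW U⁻¹ b) := by gcongr
      _ = (t * sqNormW U y) * sqNormW U⁻¹ b := by ring
      _ ≤ _ := by gcongr
  nlinarith

lemma det_add_smul_outer {A : Matrix (Fin d) (Fin d) ℝ} (hA : IsUnit A.det) (c : ℝ)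
    (b : Vec d) : (A + c • outer b).det = A.det * (1 + c * sqNormW A⁻¹ b) := by
  have h : c • outer b =
      Matrix.replicateCol Unit (c • b.ofLp) * Matrix.replicateRow Unit b.ofLp := by
    rw [← Matrix.vecMulVec_eq, outer, Matrix.smul_vecMulVec]
  rw [h, Matrix.det_add_replicateCol_mul_replicateRow hA, Matrix.det_unique (n := Unit)]
  congr 1
  rw [Matrix.add_apply, Matrix.one_apply_eq, sqNormW, Matrix.mul_assoc, ← Matrix.replicateCol_mulVec, Matrix.replicateRow_mul_replicateCol_apply,
    Matrix.mulVec_smul, dotProduct_smul, smul_eq_mul]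

end LinearAlgebra

/-! ### Optimal designs and the Kiefer–Wolfowitz bound -/

section Design

variable {d : ℕ}

lemma sqNormW_designMatrix (B : Finset (Vec d)) (π : B → ℝ) (x : Vec d) :
    sqNormW (designMatrix B π) x = ∑ b : B, π b * (inner ℝ x (b : Vec d) : ℝ) ^ 2 := by
  simp [designMatrix, sqNormW_sum, sqNormW_smul, sqNormW_outer]

lemma posSemidef_designMatrix {B : Finset (Vec d)} {π : B → ℝ} (hπ : ∀ b, 0 ≤ π b) :
    (designMatrix B π).PosSemidef :=
  Matrix.posSemidef_sum _ fun b _ => (posSemidef_outer _).smul (hπ b)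

lemma IsRegularDesign.posDef {B : Finset (Vec d)} {π : B → ℝ} (h : IsRegularDesign B π) :
    (designMatrix B π).PosDef :=
  (posSemidef_designMatrix h.1.1).posDef_iff_det_ne_zero.mpr h.2.ne_zero

lemma eq_zero_of_inner_eq_zero_of_span {B : Finset (Vec d)}
    (hB : Submodule.span ℝ (B : Set (Vec d)) = ⊤) {x : Vec d}
    (hx : ∀ b ∈ B, (inner ℝ x b : ℝ) = 0) : x = 0 := by
  have : x ∈ (Submodule.span ℝ (B : Set (Vec d)))ᗮ := by
    rw [Submodule.mem_orthogonal']
    intro u hu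
    induction hu using Submodule.span_induction with
    | mem u hu => exact hx u hu
    | zero => simp
    | add u v _ _ hu hv => rw [inner_add_right, hu, hv, add_zero]
    | smul c u _ hu => rw [inner_smul_right, hu, mul_zero]
  rw [hB] at this
  simpa using this

/-- The uniform distribution works: a vector on which its quadratic form vanishes is orthogonal to
all of `B`. -/
lemma exists_isRegularDesign {B : Finset (Vec d)} (hne : B.Nonempty)
    (hB : Submodule.span ℝ (B : Set (Vec d)) = ⊤) : ∃ π, IsRegularDesign B π := by
  have hc : (0 : ℝ) < B.card := by exact_mod_cast hne.card_pos
  have h0 : ∀ b : B, (0 : ℝ) ≤ (fun _ : B => (B.card : ℝ)⁻¹) b := fun _ => by positivity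
  refine ⟨fun _ => (B.card : ℝ)⁻¹, ⟨h0, ?_⟩, ?_⟩
  · simp [hc.ne']
  · refine (Matrix.isUnit_iff_isUnit_det _).mp (Matrix.PosDef.isUnit ?_)
    refine posDef_of_sqNormW_pos (posSemidef_designMatrix h0) fun x hx => ?_
    rw [sqNormW_designMatrix]
    have hnn : ∀ b ∈ (Finset.univ : Finset B),
        0 ≤ (B.card : ℝ)⁻¹ * (inner ℝ x (b : Vec d) : ℝ) ^ 2 := fun b _ => by positivity
    refine (Finset.sum_nonneg hnn).lt_of_ne fun h => hx ?_
    rw [eq_comm, Finset.sum_eq_zero_iff_of_nonneg hnn] at h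
    refine eq_zero_of_inner_eq_zero_of_span hB fun b hb => ?_
    simpa [hc.ne', hne.ne_empty] using h ⟨b, hb⟩ (Finset.mem_univ _)

/-- Moving mass `t` of a design to a single point. -/
lemma designMatrix_mix (B : Finset (Vec d)) (π : B → ℝ) (b : B) (t : ℝ) :
    designMatrix B ((1 - t) • π + t • Pi.single b 1) =
      (1 - t) • designMatrix B π + t • outer (b : Vec d) := by
  classical
  simp only [designMatrix, Pi.add_apply, Pi.smul_apply, smul_eq_mul, add_smul,
    Finset.sum_add_distrib, Finset.smul_sum, mul_smul]
  congr 1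
  rw [Finset.sum_eq_single b]
  · simp
  · intro c _ hc
    simp [hc]
  · simp

/-- One half of the Kiefer–Wolfowitz theorem: a `D`-optimal design `π` has `g(π) ≤ d`. -/
lemma exists_isRegularDesign_gValue_le (hd : 1 ≤ d) {B : Finset (Vec d)} (hne : B.Nonempty)
    (hB : Submodule.span ℝ (B : Set (Vec d)) = ⊤) :
    ∃ π, IsRegularDesign B π ∧ gValue B π ≤ d := by
  obtain ⟨ρ, hρ⟩ := exists_isRegularDesign hne hB
  have hcont : Continuous fun π : B → ℝ => (designMatrix B π).det := by
    refine Continuous.matrix_det ?_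
    unfold designMatrix
    fun_prop
  -- A maximizer of the determinant exists by compactness of the simplex; its determinant is
  -- positive because that of `ρ` is.
  obtain ⟨π, hπ, hmax⟩ := (isCompact_stdSimplex ℝ B).exists_isMaxOn ⟨ρ, hρ.1⟩ hcont.continuousOn
  have hpos : 0 < (designMatrix B π).det := hρ.posDef.det_pos.trans_le (hmax hρ.1)
  refine ⟨π, ⟨hπ, hpos.ne'.isUnit⟩, ?_⟩
  have : Nonempty B := hne.to_subtype
  refine ciSup_le fun b => ?_
  by_contra! hlt
  set q := sqNormW (designMatrix B π)⁻¹ (b : Vec d) with hq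
  have hd' : (1 : ℝ) ≤ d := by exact_mod_cast hd
  have hq1 : 1 < q := by linarith
  -- If `q > d`, moving mass `t` to `b` multiplies the determinant by `(1 - t)^(d-1) (1 - t + t q)`.
  -- By Bernoulli this is at least `1 + t (q - d) - (d - 1) t² (q - 1)`, which exceeds 1 once `t d q
  -- < q - d`.
  obtain ⟨t, ht0, ht1, ht⟩ : ∃ t : ℝ, 0 < t ∧ t < 1 ∧ t * (d * q) < q - d := by
    have hdq : 0 < d * q := by positivity
    refine ⟨min (1 / 2) ((q - d) / (2 * (d * q))), ?_, ?_, ?_⟩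
    · exact lt_min (by norm_num) (div_pos (by linarith) (by positivity))
    · exact (min_le_left _ _).trans_lt (by norm_num)
    · calc _ ≤ (q - d) / (2 * (d * q)) * (d * q) := by gcongr; exact min_le_right _ _
        _ = (q - d) / 2 := by field_simp
        _ < _ := by linarith
  have hmem : (1 - t) • π + t • Pi.single b 1 ∈ stdSimplex ℝ B := by
    refine convex_stdSimplex ℝ B hπ ?_ (by linarith) ht0.le (by ring)
    exact single_mem_stdSimplex ℝ b
  have hle := hmax hmem
  simp only [Set.mem_ofPred_eq] at hle
  have h1t : (0 : ℝ) < 1 - t := by linarith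
  have hunit : IsUnit ((1 - t) • designMatrix B π).det := by
    rw [Matrix.det_smul]
    exact (mul_pos (pow_pos h1t _) hpos).ne'.isUnit
  have hinv : sqNormW ((1 - t) • designMatrix B π)⁻¹ (b : Vec d) = (1 - t)⁻¹ * q := by
    rw [hq, ← sqNormW_smul]
    congr 1
    have := Matrix.inv_smul' (A := designMatrix B π) (Units.mk0 (1 - t) h1t.ne') hpos.ne'.isUnit
    simpa [Units.smul_def] using this
  rw [designMatrix_mix, det_add_smul_outer hunit, hinv, Matrix.det_smul, Fintype.card_fin] at hle
  obtain ⟨k, rfl⟩ : ∃ k, d = k + 1 := ⟨d - 1, by omega⟩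
  have hbern : 1 - k * t ≤ (1 - t) ^ k := by
    have := one_add_mul_le_pow (a := -t) (by linarith) k
    linarith [this, show (1 + -t) ^ k = (1 - t) ^ k by ring]
  have hle' : (1 - t) ^ k * (1 - t + t * q) ≤ 1 := by
    have : (1 - t) ^ (k + 1) * (designMatrix B π).det * (1 + t * ((1 - t)⁻¹ * q)) =
        (designMatrix B π).det * ((1 - t) ^ k * (1 - t + t * q)) := by
      field_simp
      ring
    rw [this] at hle
    exact (mul_le_iff_le_one_right hpos).mp hle
  have hprod : (1 - k * t) * (1 - t + t * q) ≤ 1 := by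
    refine le_trans ?_ hle'
    have : 0 ≤ 1 - t + t * q := by positivity
    gcongr
  push_cast at ht hlt
  have hk : (0 : ℝ) ≤ k := by positivity
  nlinarith [mul_pos ht0 (sub_pos.mpr ht), mul_nonneg hk (mul_pos ht0 ht0).le,
    mul_pos (mul_pos ht0 ht0) (by linarith : 0 < q)]

/-- The optimal design does at least as well as the determinant maximizer, whose value is at most
`d`; the approximation loses the factor `c`. -/
lemma IsApproxOfDesign.sqNormW_le (hd : 1 ≤ d) {B : Finset (Vec d)} (hne : B.Nonempty)
    (hB : Submodule.span ℝ (B : Set (Vec d)) = ⊤) {c : ℝ} (hc : 0 ≤ c) {πstar π : B → ℝ}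
    (hstar : IsOptimalDesign B πstar) (h : IsApproxOfDesign B c πstar π) {b : Vec d}
    (hb : b ∈ B) : sqNormW (designMatrix B π)⁻¹ b ≤ c * d := by
  obtain ⟨ρ, hρ, hρd⟩ := exists_isRegularDesign_gValue_le hd hne hB
  calc sqNormW (designMatrix B π)⁻¹ b ≤ gValue B π :=
        le_ciSup (f := fun b : B => sqNormW (designMatrix B π)⁻¹ (b : Vec d))
          (Set.finite_range _).bddAbove ⟨b, hb⟩
    _ ≤ c * gValue B πstar := h.2
    _ ≤ c * d := by gcongr; exact (hstar.2 ρ hρ).trans hρd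

end Design

/-! ### From the design to the collected samples -/

section Samples

variable {d N K m : ℕ}

lemma sqNormW_sampleMatrix (lam : ℝ) (b : Fin m → Vec d) (x : Vec d) :
    sqNormW (sampleMatrix lam b) x = lam * ‖x‖ ^ 2 + ∑ s, (inner ℝ x (b s) : ℝ) ^ 2 := by
  simp [sampleMatrix, sqNormW_add, sqNormW_smul, sqNormW_one, sqNormW_sum, sqNormW_outer]

lemma posDef_sampleMatrix {lam : ℝ} (hlam : 0 < lam) (b : Fin m → Vec d) :
    (sampleMatrix lam b).PosDef :=
  (Matrix.PosDef.one.smul hlam).add_posSemidef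
    (Matrix.posSemidef_sum _ fun _ _ => posSemidef_outer _)

lemma pairDiff_mem_diffSet (a : Fin N → Fin K → Vec d) (pair : Fin m → Fin N × Fin K × Fin K)
    (s : Fin m) : pairDiff a pair s ∈ diffSet a :=
  Finset.mem_image_of_mem _ (Finset.mem_univ (pair s))

lemma sub_mem_diffSet (a : Fin N → Fin K → Vec d) (n : Fin N) (i j : Fin K) :
    a n i - a n j ∈ diffSet a :=
  Finset.mem_image.mpr ⟨(n, i, j), Finset.mem_univ _, rfl⟩

/-- Grouping the samples by their difference, each `b` occurs `⌈T π(b)⌉ ≥ T π(b)` times; the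
regularization only adds to the right side. -/
lemma mul_sqNormW_designMatrix_le {a : Fin N → Fin K → Vec d} {T : ℕ} {π : diffSet a → ℝ}
    {pair : Fin m → Fin N × Fin K × Fin K} (hpair : IsSelectedBy a T π pair) {lam : ℝ}
    (hlam : 0 ≤ lam) (x : Vec d) :
    T * sqNormW (designMatrix (diffSet a) π) x ≤
      sqNormW (sampleMatrix lam (pairDiff a pair)) x := by
  classical
  rw [sqNormW_designMatrix, sqNormW_sampleMatrix]
  refine le_add_of_nonneg_of_le (by positivity) ?_
  have hfib := Finset.sum_fiberwise_of_maps_to (s := Finset.univ) (t := diffSet a)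
    (g := pairDiff a pair) (fun s _ => pairDiff_mem_diffSet a pair s)
    (fun s => (inner ℝ x (pairDiff a pair s) : ℝ) ^ 2)
  rw [← hfib, ← Finset.sum_coe_sort (diffSet a), Finset.mul_sum]
  refine Finset.sum_le_sum fun b _ => ?_
  rw [Finset.sum_congr rfl (g := fun _ => (inner ℝ x (b : Vec d) : ℝ) ^ 2)
    (fun s hs => by rw [(Finset.mem_filter.mp hs).2]), Finset.sum_const, nsmul_eq_mul, ← mul_assoc]
  gcongr
  have := hpair b
  calc (T : ℝ) * π b ≤ (⌈(T : ℝ) * π b⌉₊ : ℝ) := Nat.le_ceil _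
    _ = _ := by
      rw [← this]

end Samples

/-! ### Curvature of the sigmoid on `[-2, 2]` -/

section Curvature

lemma exp_add_exp_neg_le {x : ℝ} (hx : |x| ≤ 2) : Real.exp x + Real.exp (-x) ≤ 8 := by
  have h2 : Real.exp 2 + Real.exp (-2) ≤ 8 := by
    have h1 : Real.exp 1 < 2.7182818286 := Real.exp_one_lt_d9
    have h3 : Real.exp 2 = Real.exp 1 ^ 2 := by rw [← Real.exp_nat_mul]; norm_num
    have h4 : Real.exp (-2) ≤ 1 / 2 := by
      rw [Real.exp_neg, h3]
      have : (2 : ℝ) ≤ Real.exp 1 := by linarith [Real.add_one_le_exp 1]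
      rw [inv_le_comm₀ (by positivity) (by norm_num)]
      nlinarith
    rw [h3]
    nlinarith [Real.exp_pos 1]
  have h5 := Real.cosh_le_cosh.mpr (hx.trans (le_abs_self 2))
  rw [Real.cosh_eq, Real.cosh_eq] at h5
  linarith

/-- The product is `σ'(x) = 1 / (2 + eˣ + e⁻ˣ)`, and `eˣ + e⁻ˣ ≤ 8` on this interval. -/
lemma sigmoid_mul_one_sub_ge {x : ℝ} (hx : |x| ≤ 2) :
    1 / 10 ≤ Real.sigmoid x * (1 - Real.sigmoid x) := by
  have h := exp_add_exp_neg_le hx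
  have hp := Real.exp_pos (-x)
  have hq := Real.exp_pos x
  have hpq : Real.exp x * Real.exp (-x) = 1 := by rw [← Real.exp_add]; simp
  rw [← Real.sigmoid_neg, Real.sigmoid_def, Real.sigmoid_def, neg_neg, ← mul_inv, one_div]
  exact inv_anti₀ (by positivity) (by nlinarith)

lemma sigmoid_sub_mul_sub_ge {x y : ℝ} (hx : |x| ≤ 2) (hy : |y| ≤ 2) :
    1 / 10 * (x - y) ^ 2 ≤ (Real.sigmoid x - Real.sigmoid y) * (x - y) := by
  wlog hxy : y ≤ x generalizing x y
  · have := this hy hx (le_of_not_ge hxy)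
    nlinarith
  have := (convex_Icc (-2 : ℝ) 2).mul_sub_le_image_sub_of_le_deriv (f := Real.sigmoid) (C := 1 / 10)
    (by fun_prop) (by fun_prop) (fun z hz => ?_) y (Set.mem_Icc.mpr (abs_le.mp hy)) x
    (Set.mem_Icc.mpr (abs_le.mp hx)) hxy
  · nlinarith
  · rw [Real.deriv_sigmoid]
    exact sigmoid_mul_one_sub_ge (abs_le.mpr (Set.mem_Icc.mp (interior_subset hz)))

end Curvature

/-! ### Deviation of the projected maximum likelihood estimator -/

section Estimation

variable {d m : ℕ}

lemma hasDerivAt_log_sigmoid (x : ℝ) :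
    HasDerivAt (fun x => Real.log (Real.sigmoid x)) (1 - Real.sigmoid x) x := by
  have := (Real.hasDerivAt_sigmoid x).log (Real.sigmoid_pos x).ne'
  convert this using 1
  field_simp [(Real.sigmoid_pos x).ne']

/-- The first-order condition of the regularized maximum likelihood estimator. -/
lemma IsMLE.Hmap_eq {lam : ℝ} {b : Fin m → Vec d} {y : Fin m → Bool} {θ : Vec d}
    (h : IsMLE lam b y θ) :
    Hmap lam b θ = ∑ s, (if y s = true then (1 : ℝ) else 0) • b s := by
  -- This inner product is the derivative at 0 of the log-likelihood along `θ + t v`, which has a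
  -- maximum there.
  have key : ∀ v : Vec d,
      (inner ℝ v ((∑ s, (if y s = true then (1 : ℝ) else 0) • b s) - Hmap lam b θ) : ℝ) = 0 := by
    intro v
    have hlin : ∀ s, HasDerivAt (fun t : ℝ => (inner ℝ (θ + t • v) (b s) : ℝ))
        (inner ℝ v (b s)) 0 := by
      intro s
      simp only [inner_add_left, inner_smul_left, conj_trivial]
      simpa using ((hasDerivAt_id (0 : ℝ)).mul_const (inner ℝ v (b s) : ℝ)).const_add
        (inner ℝ θ (b s) : ℝ)
    have hterm : ∀ s, HasDerivAt (fun t : ℝ =>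
        if y s = true then Real.log (Real.sigmoid (inner ℝ (θ + t • v) (b s)))
          else Real.log (Real.sigmoid (-inner ℝ (θ + t • v) (b s))))
        (((if y s = true then (1 : ℝ) else 0) - Real.sigmoid (inner ℝ θ (b s))) *
          inner ℝ v (b s)) 0 := by
      intro s
      split_ifs
      · have := (hasDerivAt_log_sigmoid (inner ℝ (θ + (0 : ℝ) • v) (b s))).comp 0 (hlin s)
        simpa [Function.comp_def] using this
      · have := (hasDerivAt_log_sigmoid (-inner ℝ (θ + (0 : ℝ) • v) (b s))).comp 0 (hlin s).neg
        simpa [Real.sigmoid_neg, Function.comp_def] using this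
    have hnorm : HasDerivAt (fun t : ℝ => ‖θ + t • v‖ ^ 2) (2 * inner ℝ θ v) 0 := by
      have h1 : HasDerivAt (fun t : ℝ => θ + t • v) v 0 := by
        simpa using ((hasDerivAt_id (0 : ℝ)).smul_const v).const_add θ
      simpa using h1.norm_sq
    have hder : HasDerivAt (fun t : ℝ => logLik lam b y (θ + t • v))
        ((∑ s, ((if y s = true then (1 : ℝ) else 0) - Real.sigmoid (inner ℝ θ (b s))) *
          inner ℝ v (b s)) - lam * (2 * inner ℝ θ v) / 2) 0 :=
      (HasDerivAt.fun_sum fun s _ => hterm s).sub ((hnorm.const_mul lam).div_const 2)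
    have hmax : IsLocalMax (fun t : ℝ => logLik lam b y (θ + t • v)) 0 :=
      Filter.Eventually.of_forall fun t => by simpa using h (Set.mem_univ (θ + t • v))
    have h0 := hmax.hasDerivAt_eq_zero hder
    refine Eq.trans ?_ h0
    rw [Hmap, inner_sub_right, inner_add_right, inner_sum, inner_sum, inner_smul_right,
      real_inner_comm θ v]
    simp only [inner_smul_right, sub_mul, Finset.sum_sub_distrib]
    ring
  have := key ((∑ s, (if y s = true then (1 : ℝ) else 0) • b s) - Hmap lam b θ)
  rw [inner_self_eq_zero, sub_eq_zero] at this
  exact this.symm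

lemma normW_nonneg (A : Matrix (Fin d) (Fin d) ℝ) (x : Vec d) : 0 ≤ normW A x :=
  Real.sqrt_nonneg _

lemma abs_inner_le_normW {V : Matrix (Fin d) (Fin d) ℝ} (hV : V.PosDef) (x y : Vec d) :
    |(inner ℝ x y : ℝ)| ≤ normW V x * normW V⁻¹ y := by
  rw [normW, normW, ← Real.sqrt_mul (sqNormW_nonneg hV.posSemidef x), ← Real.sqrt_sq_eq_abs]
  exact Real.sqrt_le_sqrt (inner_sq_le_sqNormW hV x y)

lemma exists_normW_inv_eq {V : Matrix (Fin d) (Fin d) ℝ} (hV : V.PosDef) :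
    ∃ B : Vec d →ₗ[ℝ] Vec d, ∀ y, normW V⁻¹ y = ‖B y‖ := by
  obtain ⟨-, -, B, -, hB, -, -⟩ := exists_whitening hV
  exact ⟨B, fun y => by rw [normW, ← hB, Real.sqrt_sq (norm_nonneg _)]⟩

/-- The map `H` is expanding by the factor `1 / 10` on the unit ball. -/
lemma normW_sub_le_Hmap {lam : ℝ} (hlam : 0 < lam) {b : Fin m → Vec d} (hb : ∀ s, ‖b s‖ ≤ 2)
    {θ θ' : Vec d} (hθ : ‖θ‖ ≤ 1) (hθ' : ‖θ'‖ ≤ 1) :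
    normW (sampleMatrix lam b) (θ - θ') ≤
      10 * normW (sampleMatrix lam b)⁻¹ (Hmap lam b θ - Hmap lam b θ') := by
  have hV := posDef_sampleMatrix hlam b
  have hbd : ∀ {θ : Vec d}, ‖θ‖ ≤ 1 → ∀ s, |(inner ℝ θ (b s) : ℝ)| ≤ 2 := fun {θ} h s =>
    (abs_real_inner_le_norm _ _).trans (by nlinarith [hb s, norm_nonneg (b s), norm_nonneg θ])
  -- Strong monotonicity of `H`, term by term: `σ' ≥ 1/10` for the samples and `λ ≥ λ/10` for the
  -- regularization.
  have hlow : 1 / 10 * sqNormW (sampleMatrix lam b) (θ - θ') ≤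
      inner ℝ (θ - θ') (Hmap lam b θ - Hmap lam b θ') := by
    have : Hmap lam b θ - Hmap lam b θ' = lam • (θ - θ') +
        ∑ s, (Real.sigmoid (inner ℝ θ (b s)) - Real.sigmoid (inner ℝ θ' (b s))) • b s := by
      simp only [Hmap, sub_smul, Finset.sum_sub_distrib, smul_sub]
      abel
    rw [this, inner_add_right, inner_sum, sqNormW_sampleMatrix, mul_add, Finset.mul_sum]
    refine add_le_add ?_ (Finset.sum_le_sum fun s _ => ?_)
    · rw [inner_smul_right, real_inner_self_eq_norm_sq]
      nlinarith [mul_nonneg hlam.le (sq_nonneg ‖θ - θ'‖)]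
    · rw [inner_smul_right, inner_sub_left]
      exact sigmoid_sub_mul_sub_ge (hbd hθ s) (hbd hθ' s)
  have hup := (le_abs_self _).trans (abs_inner_le_normW hV (θ - θ') (Hmap lam b θ - Hmap lam b θ'))
  have hsq : sqNormW (sampleMatrix lam b) (θ - θ') = normW (sampleMatrix lam b) (θ - θ') ^ 2 :=
    (Real.sq_sqrt (sqNormW_nonneg hV.posSemidef _)).symm
  rw [hsq] at hlow
  rcases (normW_nonneg (sampleMatrix lam b) (θ - θ')).eq_or_lt with h0 | h0
  · rw [← h0]
    exact mul_nonneg (by norm_num) (normW_nonneg _ _)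
  · nlinarith

/-- The centred sum `∑ₛ (Yₛ - σ(⟨θ, bₛ⟩)) bₛ`. -/
noncomputable def noiseSum (θ : Vec d) (b : Fin m → Vec d) (y : Fin m → Bool) : Vec d :=
  ∑ s, ((if y s = true then (1 : ℝ) else 0) - Real.sigmoid (inner ℝ θ (b s))) • b s

/-- From `V ≥ λ I` follows `V⁻¹ ≤ λ⁻¹ I`; this bounds the bias due to regularization. -/
lemma normW_inv_sampleMatrix_le {lam : ℝ} (hlam : 0 < lam) (b : Fin m → Vec d) (x : Vec d) :
    normW (sampleMatrix lam b)⁻¹ (lam • x) ≤ Real.sqrt lam * ‖x‖ := by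
  have h := mul_sqNormW_inv_le (U := 1) (t := lam) Matrix.PosDef.one (posDef_sampleMatrix hlam b)
    (fun x => by
      rw [sqNormW_sampleMatrix, sqNormW_one]
      exact le_add_of_nonneg_right (by positivity)) x
  rw [inv_one, sqNormW_one] at h
  have h2 : sqNormW (sampleMatrix lam b)⁻¹ (lam • x) =
      lam * (lam * sqNormW (sampleMatrix lam b)⁻¹ x) := by
    simp [sqNormW, Matrix.mulVec_smul, dotProduct_smul, smul_dotProduct]
  rw [normW, h2, ← Real.sqrt_sq (norm_nonneg x), ← Real.sqrt_mul hlam.le]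
  gcongr

/-- Deviation of the projected maximum likelihood estimator in terms of the noise. -/
lemma IsProjectedMLE.normW_sub_le {lam : ℝ} (hlam : 0 < lam) {b : Fin m → Vec d}
    (hb : ∀ s, ‖b s‖ ≤ 2) {y : Fin m → Bool} {θstar θhat θP : Vec d} (hθ : ‖θstar‖ ≤ 1)
    (hMLE : IsMLE lam b y θhat) (hP : IsProjectedMLE lam b θhat θP) :
    normW (sampleMatrix lam b) (θstar - θP) ≤
      20 * (normW (sampleMatrix lam b)⁻¹ (noiseSum θstar b y) + Real.sqrt lam) := by
  obtain ⟨B, hB⟩ := exists_normW_inv_eq (posDef_sampleMatrix hlam b)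
  have h1 := normW_sub_le_Hmap hlam hb hθ (mem_closedBall_zero_iff.mp hP.1)
  have h2 := hP.2 (mem_closedBall_zero_iff.mpr hθ)
  have h4 := normW_inv_sampleMatrix_le hlam b θstar
  simp only [Set.mem_ofPred_eq] at h2
  have h3 : Hmap lam b θstar - Hmap lam b θhat = lam • θstar - noiseSum θstar b y := by
    rw [hMLE.Hmap_eq, Hmap, noiseSum]
    simp only [sub_smul, Finset.sum_sub_distrib]
    abel
  rw [h3] at h2
  simp only [hB, map_sub] at h1 h2 h4 ⊢
  -- As `θstar` competes in the projection, `H(θP)` is no farther from `H(θhat)` than `H(θstar)` is.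
  -- The triangle inequality through `H(θhat)` thus doubles the factor 10.
  have h5 : ‖B (Hmap lam b θstar) - B (Hmap lam b θP)‖ ≤
      ‖B (lam • θstar) - B (noiseSum θstar b y)‖ + ‖B (Hmap lam b θP) - B (Hmap lam b θhat)‖ := by
    rw [← map_sub B (lam • θstar), ← h3, map_sub]
    have := norm_sub_le (B (Hmap lam b θstar) - B (Hmap lam b θhat))
      (B (Hmap lam b θP) - B (Hmap lam b θhat))
    simpa using this
  have h6 := norm_sub_le (B (lam • θstar)) (B (noiseSum θstar b y))
  have h7 : Real.sqrt lam * ‖θstar‖ ≤ Real.sqrt lam :=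
    mul_le_of_le_one_right (Real.sqrt_nonneg _) hθ
  linarith

end Estimation

/-! ### Concentration of the label noise -/

section Concentration

variable {d m : ℕ} {Ω : Type*} [MeasurableSpace Ω] {μ : Measure Ω}

/-- Variance 2 is the one with moment generating function `exp(t²)`. The density is proportional to
`exp(-x²/4)`, so the integrand becomes `exp(-x²/8)`, and the ratio of normalizations is `√(8π) /
√(4π)`. -/
lemma integral_exp_sq_div_eight_gaussianReal :
    ∫ x, Real.exp (x ^ 2 / 8) ∂(gaussianReal 0 2) = Real.sqrt 2 := by
  rw [integral_gaussianReal_eq_integral_smul (by norm_num)]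
  have : ∀ x : ℝ, gaussianPDFReal 0 2 x • Real.exp (x ^ 2 / 8) =
      (Real.sqrt (4 * Real.pi))⁻¹ * Real.exp (-(1 / 8) * x ^ 2) := by
    intro x
    rw [gaussianPDFReal, smul_eq_mul, mul_assoc, ← Real.exp_add]
    congr 2
    · push_cast; ring_nf
    · push_cast; ring
  simp_rw [this]
  rw [integral_const_mul, integral_gaussian, ← Real.sqrt_inv, ← Real.sqrt_mul (by positivity)]
  congr 1
  field_simp
  norm_num

lemma integrable_exp_sq_div_eight_gaussianReal :
    Integrable (fun x => Real.exp (x ^ 2 / 8)) (gaussianReal 0 2) := by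
  by_contra h
  -- A non-integrable function would have integral 0 by convention, not `√2`.
  have := integral_undef h
  rw [integral_exp_sq_div_eight_gaussianReal] at this
  have h2 : 0 < Real.sqrt 2 := by positivity
  linarith

/-- Gaussian linearization of `exp ‖w‖²`. -/
lemma lintegral_exp_inner_gaussian (w : Vec d) :
    ∫⁻ g : Fin d → ℝ, ENNReal.ofReal (Real.exp (inner ℝ (WithLp.toLp 2 g) w))
      ∂(Measure.pi fun _ => gaussianReal 0 2) = ENNReal.ofReal (Real.exp (‖w‖ ^ 2)) := by
  have hprod : ∀ g : Fin d → ℝ,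
      Real.exp (inner ℝ (WithLp.toLp 2 g) w) = ∏ i, Real.exp (w i * g i) := by
    intro g
    rw [← Real.exp_sum]
    simp [PiLp.inner_apply]
  have hint : ∀ i, Integrable (fun x => Real.exp (w i * x)) (gaussianReal 0 2) :=
    fun i => integrable_exp_mul_gaussianReal (w i)
  have hval : ∀ t : ℝ, ∫ x, Real.exp (t * x) ∂(gaussianReal 0 2) = Real.exp (t ^ 2) := by
    intro t
    have := congrFun (mgf_fun_id_gaussianReal (μ := 0) (v := 2)) t
    rw [mgf] at this
    rw [this]
    congr 1
    push_cast
    ring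
  simp_rw [hprod]
  rw [← ofReal_integral_eq_lintegral_ofReal (Integrable.fintype_prod hint)
    (ae_of_all _ fun g => by positivity)]
  rw [integral_fintype_prod_eq_prod (fun i x => Real.exp (w i * x))]
  simp_rw [hval]
  rw [← Real.exp_sum, EuclideanSpace.norm_sq_eq]
  simp

lemma lintegral_exp_sq_norm_gaussian :
    ∫⁻ g : Fin d → ℝ, ENNReal.ofReal (Real.exp (‖(WithLp.toLp 2 g : Vec d)‖ ^ 2 / 8))
      ∂(Measure.pi fun _ => gaussianReal 0 2) = ENNReal.ofReal (Real.sqrt 2 ^ d) := by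
  have hprod : ∀ g : Fin d → ℝ,
      Real.exp (‖(WithLp.toLp 2 g : Vec d)‖ ^ 2 / 8) = ∏ i, Real.exp (g i ^ 2 / 8) := by
    intro g
    rw [← Real.exp_sum, EuclideanSpace.norm_sq_eq, Finset.sum_div]
    simp
  simp_rw [hprod]
  rw [← ofReal_integral_eq_lintegral_ofReal
    (Integrable.fintype_prod fun _ => integrable_exp_sq_div_eight_gaussianReal)
    (ae_of_all _ fun g => by positivity)]
  rw [integral_fintype_prod_eq_prod (fun _ x => Real.exp (x ^ 2 / 8))]
  simp [integral_exp_sq_div_eight_gaussianReal]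

/-- A sub-Gaussian vector with variance proxy `1 / 4` has an exponentially integrable square. -/
lemma lintegral_exp_sq_norm_le [SFinite μ] {W : Ω → Vec d} (hW : Measurable W)
    (h : ∀ g : Vec d, ∫⁻ ω, ENNReal.ofReal (Real.exp (inner ℝ g (W ω))) ∂μ ≤
      ENNReal.ofReal (Real.exp (‖g‖ ^ 2 / 8))) :
    ∫⁻ ω, ENNReal.ofReal (Real.exp (‖W ω‖ ^ 2)) ∂μ ≤ ENNReal.ofReal (Real.sqrt 2 ^ d) := by
  -- Writing `exp ‖W‖²` as a Gaussian average of `exp ⟨g, W⟩` makes the exponent linear in `W`;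
  -- after Tonelli the hypothesis applies for each fixed `g`.
  simp_rw [← lintegral_exp_inner_gaussian]
  rw [lintegral_lintegral_swap]
  · rw [← lintegral_exp_sq_norm_gaussian]
    exact lintegral_mono fun g => h _
  · refine Measurable.aemeasurable ?_
    have : Measurable fun p : Ω × (Fin d → ℝ) => (WithLp.toLp 2 p.2 : Vec d) :=
      (WithLp.measurable_toLp 2 _).comp measurable_snd
    exact ENNReal.measurable_ofReal.comp
      (Real.measurable_exp.comp (this.inner (hW.comp measurable_fst)))

/-- Markov's inequality for `exp ‖W‖²`; the level solves `exp u = 2^(d/2) / δ`. -/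
lemma one_sub_le_measureReal_sq_norm_le [IsProbabilityMeasure μ] {W : Ω → Vec d}
    (hW : Measurable W)
    (h : ∀ g : Vec d, ∫⁻ ω, ENNReal.ofReal (Real.exp (inner ℝ g (W ω))) ∂μ ≤
      ENNReal.ofReal (Real.exp (‖g‖ ^ 2 / 8))) {δ : ℝ} (hδ : 0 < δ) :
    1 - δ ≤ μ.real {ω | ‖W ω‖ ^ 2 ≤ Real.log (1 / δ) + d / 2 * Real.log 2} := by
  set u := Real.log (1 / δ) + d / 2 * Real.log 2 with hu
  have hexp : Real.exp u = Real.sqrt 2 ^ d / δ := by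
    rw [hu, Real.exp_add, Real.exp_log (by positivity), Real.sqrt_eq_rpow, ← Real.rpow_natCast,
      ← Real.rpow_mul (by norm_num), Real.rpow_def_of_pos (by norm_num)]
    ring_nf
  have hmeas : Measurable fun ω => ENNReal.ofReal (Real.exp (‖W ω‖ ^ 2)) := by fun_prop
  have hS : MeasurableSet {ω | ‖W ω‖ ^ 2 ≤ u} := measurableSet_le (by fun_prop) (by fun_prop)
  have hc : μ.real {ω | ‖W ω‖ ^ 2 ≤ u}ᶜ ≤ δ := by
    refine ENNReal.toReal_le_of_le_ofReal hδ.le ?_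
    have hsub : {ω | ‖W ω‖ ^ 2 ≤ u}ᶜ ⊆
        {ω | ENNReal.ofReal (Real.exp u) ≤ ENNReal.ofReal (Real.exp (‖W ω‖ ^ 2))} := by
      intro ω hω
      simp only [Set.mem_compl_iff, Set.mem_ofPred_eq, not_le] at hω
      exact ENNReal.ofReal_le_ofReal (Real.exp_le_exp.mpr hω.le)
    have hpos : ENNReal.ofReal (Real.exp u) ≠ 0 := by simp [Real.exp_pos]
    calc μ _ ≤ _ := measure_mono hsub
      _ ≤ (∫⁻ ω, ENNReal.ofReal (Real.exp (‖W ω‖ ^ 2)) ∂μ) / ENNReal.ofReal (Real.exp u) :=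
        meas_ge_le_lintegral_div hmeas.aemeasurable hpos ENNReal.ofReal_ne_top
      _ ≤ ENNReal.ofReal (Real.sqrt 2 ^ d) / ENNReal.ofReal (Real.exp u) := by
        gcongr
        exact lintegral_exp_sq_norm_le hW h
      _ = ENNReal.ofReal δ := by
        rw [← ENNReal.ofReal_div_of_pos (Real.exp_pos _), hexp]
        congr 1
        field_simp
  rw [measureReal_compl hS] at hc
  simp only [probReal_univ] at hc
  linarith

/-- Hoeffding's lemma for a variable in `[0, 1]`: the proxy is `(1/2)² = 1/4`. -/
lemma IsPreferenceFeedback.hasSubgaussianMGF [IsProbabilityMeasure μ] {θ : Vec d}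
    {b : Fin m → Vec d} {Y : Fin m → Ω → Bool} (hY : IsPreferenceFeedback μ θ b Y) (s : Fin m) :
    HasSubgaussianMGF (fun ω => (if Y s ω = true then (1 : ℝ) else 0) -
      Real.sigmoid (inner ℝ θ (b s))) (1 / 4) μ := by
  have hset : MeasurableSet {ω | Y s ω = true} := hY.1 s (measurableSet_singleton true)
  have hmeas : Measurable fun ω => if Y s ω = true then (1 : ℝ) else 0 :=
    Measurable.ite hset measurable_const measurable_const
  have hmean : ∫ ω, (if Y s ω = true then (1 : ℝ) else 0) ∂μ =
      Real.sigmoid (inner ℝ θ (b s)) := by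
    rw [← hY.2.2 s, ← integral_indicator_one hset]
    congr with ω
    simp [Set.indicator]
  have := hasSubgaussianMGF_of_mem_Icc (a := 0) (b := 1) hmeas.aemeasurable
    (ae_of_all μ fun ω => by split_ifs <;> simp)
  rw [hmean] at this
  convert this using 1
  ext
  norm_num

lemma IsPreferenceFeedback.measurable_noiseSum {θ : Vec d}
    {b : Fin m → Vec d} {Y : Fin m → Ω → Bool} (hY : IsPreferenceFeedback μ θ b Y) :
    Measurable fun ω => noiseSum θ b fun s => Y s ω := by
  unfold noiseSum
  refine Finset.measurable_sum _ fun s _ => ?_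
  have hmeas : Measurable fun ω => if Y s ω = true then (1 : ℝ) else 0 :=
    Measurable.ite (hY.1 s (measurableSet_singleton true)) measurable_const measurable_const
  fun_prop

lemma IsPreferenceFeedback.lintegral_exp_inner_noiseSum_le [IsProbabilityMeasure μ] {θ : Vec d}
    {b : Fin m → Vec d} {Y : Fin m → Ω → Bool} (hY : IsPreferenceFeedback μ θ b Y) (h : Vec d) :
    ∫⁻ ω, ENNReal.ofReal (Real.exp (inner ℝ h (noiseSum θ b fun s => Y s ω))) ∂μ ≤
      ENNReal.ofReal (Real.exp ((∑ s, (inner ℝ h (b s) : ℝ) ^ 2) / 8)) := by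
  have hind : iIndepFun (fun s ω => (inner ℝ h (b s) : ℝ) *
      ((if Y s ω = true then (1 : ℝ) else 0) - Real.sigmoid (inner ℝ θ (b s)))) μ :=
    hY.2.1.comp (fun s y => (inner ℝ h (b s) : ℝ) *
      ((if y = true then (1 : ℝ) else 0) - Real.sigmoid (inner ℝ θ (b s))))
      fun s => measurable_of_finite _
  have hsub := HasSubgaussianMGF.sum_of_iIndepFun hind (s := Finset.univ)
    fun s _ => (hY.hasSubgaussianMGF s).const_mul (inner ℝ h (b s))
  have heq : ∀ ω, (inner ℝ h (noiseSum θ b fun s => Y s ω) : ℝ) =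
      ∑ s, (inner ℝ h (b s) : ℝ) *
      ((if Y s ω = true then (1 : ℝ) else 0) - Real.sigmoid (inner ℝ θ (b s))) := by
    intro ω
    rw [noiseSum, inner_sum]
    exact Finset.sum_congr rfl fun s _ => by rw [inner_smul_right, mul_comm]
  simp_rw [heq]
  have hi := hsub.integrable_exp_mul 1
  have hm := hsub.mgf_le 1
  simp only [mgf, one_mul] at hi hm
  rw [← ofReal_integral_eq_lintegral_ofReal hi (ae_of_all _ fun _ => (Real.exp_pos _).le)]
  refine ENNReal.ofReal_le_ofReal (hm.trans (le_of_eq ?_))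
  congr 1
  have hcoe : ∀ s, ((⟨(inner ℝ h (b s) : ℝ) ^ 2, sq_nonneg _⟩ * (1 / 4) : NNReal) : ℝ) =
      (inner ℝ h (b s) : ℝ) ^ 2 * (1 / 4) := fun _ => rfl
  rw [NNReal.coe_sum, Finset.sum_congr rfl fun s _ => hcoe s, ← Finset.sum_mul]
  ring

/-- Concentration of the noise in the norm given by the (deterministic) sample matrix. -/
lemma IsPreferenceFeedback.one_sub_le_measureReal [IsProbabilityMeasure μ] {θ : Vec d}
    {b : Fin m → Vec d} {Y : Fin m → Ω → Bool} (hY : IsPreferenceFeedback μ θ b Y) {lam : ℝ}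
    (hlam : 0 < lam) {δ : ℝ} (hδ : 0 < δ) :
    1 - δ ≤ μ.real {ω | normW (sampleMatrix lam b)⁻¹ (noiseSum θ b fun s => Y s ω) ≤
      Real.sqrt (Real.log (1 / δ) + d / 2 * Real.log 2)} := by
  obtain ⟨C, D, B, hC, hB, hCB, hCD⟩ := exists_whitening (posDef_sampleMatrix hlam b)
  have hBm : Measurable B := (LinearMap.continuous_of_finiteDimensional B).measurable
  refine (one_sub_le_measureReal_sq_norm_le (W := fun ω => B (noiseSum θ b fun s => Y s ω))
    (hBm.comp hY.measurable_noiseSum) (fun g => ?_) hδ).trans (measureReal_mono fun ω hω => ?_)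
  · have hadj : ∀ y, (inner ℝ g (B y) : ℝ) = inner ℝ (D g) y := fun y => by
      rw [← hCB (D g) y, hCD]
    simp_rw [hadj]
    refine (hY.lintegral_exp_inner_noiseSum_le (D g)).trans ?_
    gcongr
    -- The proxy in direction `g` is controlled by `∑ₛ ⟨D g, bₛ⟩² ≤ ‖D g‖²_V = ‖C (D g)‖² = ‖g‖²`.
    rw [← hCD g, hC, hCD, sqNormW_sampleMatrix]
    exact le_add_of_nonneg_left (by positivity)
  · simp only [Set.mem_ofPred_eq, hB] at hω ⊢
    exact Real.sqrt_le_sqrt hω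

end Concentration

/-! ### From estimation error to simple regret -/

section Regret

variable {d N K m : ℕ}

lemma norm_sub_le_two {x y : Vec d} (hx : ‖x‖ ≤ 1) (hy : ‖y‖ ≤ 1) : ‖x - y‖ ≤ 2 :=
  (norm_sub_le _ _).trans (by linarith)

lemma simpleRegret_le [Nonempty (Fin N)] [Nonempty (Fin K)] {a : Fin N → Fin K → Vec d}
    {θ : Vec d} {ahat : Fin N → Vec d} {r : ℝ}
    (h : ∀ n k, (inner ℝ θ (a n k - ahat n) : ℝ) ≤ r) : simpleRegret a θ ahat ≤ r :=
  ciSup_le fun n => ciSup_le fun k => h n k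

lemma simpleRegret_nonneg [Nonempty (Fin N)] {a : Fin N → Fin K → Vec d}
    {θ : Vec d} {ahat : Fin N → Vec d} (h : ∀ n, ahat n ∈ Set.range (a n)) :
    0 ≤ simpleRegret a θ ahat := by
  obtain ⟨n⟩ := ‹Nonempty (Fin N)›
  obtain ⟨k, hk⟩ := h n
  have h1 := le_ciSup (f := fun k => (inner ℝ θ (a n k - ahat n) : ℝ))
    (Set.finite_range _).bddAbove k
  have h2 := le_ciSup (f := fun n => ⨆ k, (inner ℝ θ (a n k - ahat n) : ℝ))
    (Set.finite_range _).bddAbove n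
  have h0 : (inner ℝ θ (a n k - ahat n) : ℝ) = 0 := by rw [hk, sub_self, inner_zero_right]
  exact h0.symm.le.trans (h1.trans h2)

lemma simpleRegret_le_two [Nonempty (Fin N)] [Nonempty (Fin K)] {a : Fin N → Fin K → Vec d}
    (ha : ∀ n k, ‖a n k‖ ≤ 1) {θ : Vec d} (hθ : ‖θ‖ ≤ 1) {ahat : Fin N → Vec d}
    (h : ∀ n, ahat n ∈ Set.range (a n)) : simpleRegret a θ ahat ≤ 2 := by
  refine simpleRegret_le fun n k => (real_inner_le_norm _ _).trans ?_
  obtain ⟨j, hj⟩ := h n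
  have := norm_sub_le_two (ha n k) (ha n j)
  rw [← hj]
  nlinarith [norm_nonneg θ, norm_nonneg (a n k - a n j)]

lemma measurable_simpleRegret {Ω : Type*} [MeasurableSpace Ω] (a : Fin N → Fin K → Vec d)
    (θ : Vec d) {ahat : Fin N → Ω → Vec d} (h : ∀ n, Measurable (ahat n)) :
    Measurable fun ω => simpleRegret a θ fun n => ahat n ω := by
  unfold simpleRegret
  refine Measurable.iSup fun n => Measurable.iSup fun k => ?_
  exact Measurable.const_inner (measurable_const.sub (h n))

/-- The regret of an output of the procedure is controlled by the noise of the labels. -/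
lemma IsOutput.simpleRegret_le_noise [Nonempty (Fin N)] [Nonempty (Fin K)] (hd : 1 ≤ d) {T : ℕ}
    (hT : 0 < T) {a : Fin N → Fin K → Vec d} (ha : ∀ n k, ‖a n k‖ ≤ 1)
    (hspan : Submodule.span ℝ (diffSet a : Set (Vec d)) = ⊤) {θstar : Vec d} (hθ : ‖θstar‖ ≤ 1)
    {c : ℝ} (hc : 0 ≤ c) {πstar πhat : diffSet a → ℝ}
    (hπstar : IsOptimalDesign (diffSet a) πstar)
    (hπhat : IsApproxOfDesign (diffSet a) c πstar πhat)
    {pair : Fin m → Fin N × Fin K × Fin K} (hpair : IsSelectedBy a T πhat pair)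
    {lam : ℝ} (hlam : 0 < lam) {y : Fin m → Bool} {ahat : Fin N → Vec d}
    (hout : IsOutput a lam pair y ahat) :
    simpleRegret a θstar ahat ≤
      20 * (normW (sampleMatrix lam (pairDiff a pair))⁻¹ (noiseSum θstar (pairDiff a pair) y) +
        Real.sqrt lam) * Real.sqrt (c * d / T) := by
  obtain ⟨θhat, θP, hMLE, hP, hahat⟩ := hout
  have hV := posDef_sampleMatrix hlam (pairDiff a pair)
  have hT' : (0 : ℝ) < T := by exact_mod_cast hT
  have hb : ∀ s, ‖pairDiff a pair s‖ ≤ 2 := fun s => norm_sub_le_two (ha _ _) (ha _ _)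
  refine simpleRegret_le fun n k => ?_
  obtain ⟨⟨j, hj⟩, hopt⟩ := hahat n
  have hmem : a n k - ahat n ∈ diffSet a := hj ▸ sub_mem_diffSet a n k j
  have hnorm : normW (sampleMatrix lam (pairDiff a pair))⁻¹ (a n k - ahat n) ≤
      Real.sqrt (c * d / T) := by
    refine Real.sqrt_le_sqrt ?_
    rw [le_div_iff₀ hT', mul_comm]
    exact (mul_sqNormW_inv_le hπhat.1.posDef hV
      (mul_sqNormW_designMatrix_le hpair hlam.le) _).trans
      (hπhat.sqNormW_le hd ⟨_, hmem⟩ hspan hc hπstar hmem)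
  calc (inner ℝ θstar (a n k - ahat n) : ℝ)
      -- Optimality of the choice under `θP` makes `⟨θP, a n k - ahat n⟩` nonpositive, so
      -- subtracting it only increases the value.
      ≤ inner ℝ (θstar - θP) (a n k - ahat n) := by
        rw [inner_sub_left, inner_sub_right θP]
        linarith [hopt k]
    _ ≤ _ := (le_abs_self _).trans (abs_inner_le_normW hV _ _)
    _ ≤ _ := mul_le_mul (hP.normW_sub_le hlam hb hθ hMLE) hnorm (normW_nonneg _ _)
        (mul_nonneg (by norm_num) (add_nonneg (normW_nonneg _ _) (Real.sqrt_nonneg _)))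

end Regret

/-! ### Numerical constants and the expectation -/

section Bounds

variable {d T : ℕ}

lemma rpow_one_sub_inv_le (hd : 1 ≤ d) : (d : ℝ) ^ (1 - 1 / (d : ℝ)) ≤ d := by
  have hd' : (1 : ℝ) ≤ d := by exact_mod_cast hd
  conv_rhs => rw [← Real.rpow_one (d : ℝ)]
  refine Real.rpow_le_rpow_of_exponent_le hd' ?_
  have : 0 ≤ 1 / (d : ℝ) := by positivity
  linarith

/-- Since `d^(1-1/d) ≤ d ≤ d² ≤ T`, the quotient is at least 4. Its logarithm therefore dominates
the `log 2` of the noise bound. -/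
lemma four_le_div_rpow (hd : 1 ≤ d) (hT : d ^ 2 ≤ T) :
    4 ≤ (1 + 4 * (T : ℝ)) / (d : ℝ) ^ (1 - 1 / (d : ℝ)) := by
  have hd' : (1 : ℝ) ≤ d := by exact_mod_cast hd
  have hT' : (d : ℝ) ^ 2 ≤ T := by exact_mod_cast hT
  rw [le_div_iff₀ (by positivity)]
  nlinarith [rpow_one_sub_inv_le hd]

lemma log_two_le_log_div_rpow (hd : 1 ≤ d) (hT : d ^ 2 ≤ T) :
    Real.log 2 ≤ Real.log ((1 + 4 * (T : ℝ)) / (d : ℝ) ^ (1 - 1 / (d : ℝ))) :=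
  Real.log_le_log (by norm_num) (by linarith [four_le_div_rpow hd hT])

lemma regret_bound_le (hd : 1 ≤ d) (hT : d ^ 2 ≤ T) {δ : ℝ} (hδ : 0 < δ) (hδ1 : δ < 1) {w : ℝ}
    (hw : w ≤ Real.sqrt (Real.log (1 / δ) + d / 2 * Real.log 2)) :
    20 * (w + Real.sqrt (1 / (d : ℝ))) * Real.sqrt (3 / 2 * d / T) ≤
      30 * Real.sqrt ((d : ℝ) / T) *
        (Real.sqrt (2 * Real.log (1 / δ) +
            d * Real.log ((1 + 4 * (T : ℝ)) / (d : ℝ) ^ (1 - 1 / (d : ℝ)))) +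
          1 / Real.sqrt d) := by
  have hlog : 0 ≤ Real.log (1 / δ) := Real.log_nonneg (by rw [le_div_iff₀ hδ]; linarith)
  have hlog2 : 0 ≤ Real.log 2 := Real.log_nonneg (by norm_num)
  -- Bounding `√(3/2)` by `3/2` turns the constant 20 into 30.
  have h1 : Real.sqrt (3 / 2 * d / T) ≤ 3 / 2 * Real.sqrt ((d : ℝ) / T) := by
    rw [mul_div_assoc, Real.sqrt_mul (by norm_num)]
    gcongr
    rw [Real.sqrt_le_left (by norm_num)]
    norm_num
  have h2 : w ≤ Real.sqrt (2 * Real.log (1 / δ) +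
      d * Real.log ((1 + 4 * (T : ℝ)) / (d : ℝ) ^ (1 - 1 / (d : ℝ)))) := by
    refine hw.trans (Real.sqrt_le_sqrt (add_le_add (by linarith) ?_))
    have := log_two_le_log_div_rpow hd hT
    have hd0 : (0 : ℝ) ≤ d := by positivity
    nlinarith [mul_le_mul_of_nonneg_left this hd0, mul_nonneg hd0 hlog2]
  rw [Real.sqrt_div zero_le_one, Real.sqrt_one]
  have h3 : 0 ≤ 1 / Real.sqrt d := by positivity
  calc _ ≤ 20 * (Real.sqrt (2 * Real.log (1 / δ) +
        d * Real.log ((1 + 4 * (T : ℝ)) / (d : ℝ) ^ (1 - 1 / (d : ℝ)))) + 1 / Real.sqrt d) *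
        (3 / 2 * Real.sqrt ((d : ℝ) / T)) := by gcongr
    _ = _ := by ring

/-- At the level `δ` used for the expectation, `log (1/δ)` equals the other logarithm, and both are
`L`. The last term `2δ` is the cost of the bad event, where the regret is at most 2. -/
lemma expectation_bound_le (hd : 1 ≤ d) (hT : d ^ 2 ≤ T) {L δ : ℝ} (hL : 0 ≤ L)
    (hδ : δ ≤ d / (4 * T)) :
    30 * Real.sqrt ((d : ℝ) / T) * (Real.sqrt (2 * L + d * L) + 1 / Real.sqrt d) + 2 * δ ≤
      30 * (((d : ℝ) + 2) / Real.sqrt T) * Real.sqrt L + 31 / Real.sqrt T := by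
  have hd' : (1 : ℝ) ≤ d := by exact_mod_cast hd
  have hT' : (d : ℝ) ^ 2 ≤ T := by exact_mod_cast hT
  have hT0 : (0 : ℝ) < T := by nlinarith
  have hdT : (d : ℝ) ≤ Real.sqrt T := Real.le_sqrt_of_sq_le hT'
  have hs : 0 < Real.sqrt T := Real.sqrt_pos.mpr hT0
  have hsd : 0 < Real.sqrt d := Real.sqrt_pos.mpr (by linarith)
  -- As `d ≤ √T`, even `2δ ≤ 1 / (2√T)` holds; this accounts for 31 in place of 30.
  have hδ' : 2 * δ ≤ 1 / Real.sqrt T := by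
    calc 2 * δ ≤ 2 * (d / (4 * T)) := by gcongr
      _ ≤ 2 * (Real.sqrt T / (4 * T)) := by gcongr
      _ = 1 / 2 * (1 / Real.sqrt T) := by
        nth_rewrite 2 [← Real.mul_self_sqrt hT0.le]
        field_simp
        norm_num
      _ ≤ _ := by
        have : 0 ≤ 1 / Real.sqrt T := by positivity
        linarith
  -- After squaring, this is `d (d + 2) ≤ (d + 2)²`.
  have hmain : Real.sqrt d * Real.sqrt (2 * L + d * L) ≤ (d + 2) * Real.sqrt L := by
    rw [← Real.sqrt_mul (by linarith), ← Real.sqrt_sq (by linarith : (0 : ℝ) ≤ d + 2),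
      ← Real.sqrt_mul (sq_nonneg _)]
    refine Real.sqrt_le_sqrt ?_
    nlinarith [mul_nonneg (by linarith : (0 : ℝ) ≤ d) hL]
  have hexp : 30 * Real.sqrt ((d : ℝ) / T) * (Real.sqrt (2 * L + d * L) + 1 / Real.sqrt d) =
      30 * (Real.sqrt d * Real.sqrt (2 * L + d * L)) / Real.sqrt T + 30 / Real.sqrt T := by
    rw [Real.sqrt_div (by linarith)]
    field_simp
  rw [hexp]
  have : 30 * (Real.sqrt d * Real.sqrt (2 * L + d * L)) / Real.sqrt T ≤
      30 * (((d : ℝ) + 2) / Real.sqrt T) * Real.sqrt L := by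
    rw [show 30 * (((d : ℝ) + 2) / Real.sqrt T) * Real.sqrt L =
      30 * ((d + 2) * Real.sqrt L) / Real.sqrt T by ring]
    gcongr
  have h31 : 31 / Real.sqrt T = 30 / Real.sqrt T + 1 / Real.sqrt T := by ring
  linarith

/-- From a tail bound at one level to a bound of the expectation. -/
lemma integral_le_add_mul {Ω : Type*} [MeasurableSpace Ω] {μ : Measure Ω} [IsProbabilityMeasure μ]
    {X : Ω → ℝ} (hX : Measurable X) {M r δ : ℝ} (hM : ∀ ω, X ω ≤ M) (hM0 : 0 ≤ M) (hr : 0 ≤ r)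
    (hint : Integrable X μ) (h : 1 - δ ≤ μ.real {ω | X ω ≤ r}) :
    ∫ ω, X ω ∂μ ≤ r + M * δ := by
  have hS : MeasurableSet {ω | X ω ≤ r} := measurableSet_le hX measurable_const
  have hc : μ.real {ω | X ω ≤ r}ᶜ ≤ δ := by
    rw [measureReal_compl hS, probReal_univ]
    linarith
  have hi : Integrable ({ω | X ω ≤ r}ᶜ.indicator fun _ => M) μ :=
    (integrable_const M).indicator hS.compl
  calc ∫ ω, X ω ∂μ ≤ ∫ ω, (r + {ω | X ω ≤ r}ᶜ.indicator (fun _ => M) ω) ∂μ := by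
        refine integral_mono hint ((integrable_const r).add hi) fun ω => ?_
        by_cases hω : X ω ≤ r
        · simp [hω]
        · simpa [hω] using (hM ω).trans (le_add_of_nonneg_left hr)
    _ = r + M * μ.real {ω | X ω ≤ r}ᶜ := by
        rw [integral_add (integrable_const r) hi, integral_indicator hS.compl]
        simp [mul_comm]
    _ ≤ r + M * δ := by gcongr

end Bounds

end ODPO

theorem corollary1 {d N K T m : ℕ} (hd : 1 ≤ d) (hT : d ^ 2 ≤ T)
    -- the actions, and their differences span the space
    (a : Fin N → Fin K → ODPO.Vec d)
    (ha : ∀ n k, a n k ∈ Metric.closedBall (0 : ODPO.Vec d) 1)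
    (hspan : Submodule.span ℝ (ODPO.diffSet a : Set (ODPO.Vec d)) = ⊤)
    (θstar : ODPO.Vec d) (hθ : θstar ∈ Metric.closedBall (0 : ODPO.Vec d) 1)
    -- the optimal design and its approximation
    (πstar πhat : ODPO.diffSet a → ℝ)
    (hπstar : ODPO.IsOptimalDesign (ODPO.diffSet a) πstar)
    (hπhat : ODPO.IsApproxOfDesign (ODPO.diffSet a) (3 / 2) πstar πhat)
    -- the selected pairs
    (pair : Fin m → Fin N × Fin K × Fin K)
    (hpair : ODPO.IsSelectedBy a T πhat pair)
    -- the labels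
    {Ω : Type*} [MeasurableSpace Ω] (μ : Measure Ω) [IsProbabilityMeasure μ]
    (Y : Fin m → Ω → Bool)
    (hY : ODPO.IsPreferenceFeedback μ θstar (ODPO.pairDiff a pair) Y)
    -- the actions that the procedure outputs, with regularization `1 / d`
    (ahat : Fin N → Ω → ODPO.Vec d) (hahat_meas : ∀ n, Measurable (ahat n))
    (hahat : ∀ ω, ODPO.IsOutput a (1 / (d : ℝ)) pair (fun s => Y s ω) (fun n => ahat n ω)) :
    (∀ δ : ℝ, 0 < δ → δ < 1 →
      1 - δ ≤ μ.real {ω | ODPO.simpleRegret a θstar (fun n => ahat n ω) ≤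
        30 * Real.sqrt ((d : ℝ) / T) *
          (Real.sqrt (2 * Real.log (1 / δ) +
              d * Real.log ((1 + 4 * (T : ℝ)) / (d : ℝ) ^ (1 - 1 / (d : ℝ)))) +
            1 / Real.sqrt d)}) ∧
    Integrable (fun ω => ODPO.simpleRegret a θstar (fun n => ahat n ω)) μ ∧
    ∫ ω, ODPO.simpleRegret a θstar (fun n => ahat n ω) ∂μ ≤
      30 * (((d : ℝ) + 2) / Real.sqrt T) *
          Real.sqrt (Real.log ((4 * (T : ℝ) + 1) / (d : ℝ) ^ (1 - 1 / (d : ℝ)))) +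
        31 / Real.sqrt T := by
  have hd' : (1 : ℝ) ≤ d := by exact_mod_cast hd
  have hT' : (d : ℝ) ^ 2 ≤ T := by exact_mod_cast hT
  have hTpos : 0 < T := lt_of_lt_of_le (by positivity) hT
  have hlam : 0 < 1 / (d : ℝ) := by positivity
  -- The empty set cannot span, as `d ≥ 1`. Hence there are contexts and actions, and the suprema in
  -- the regret are over nonempty sets.
  have hne : (ODPO.diffSet a).Nonempty := by
    by_contra h
    rw [Finset.not_nonempty_iff_eq_empty] at h
    rw [h, Finset.coe_empty, Submodule.span_empty] at hspan
    have hv : EuclideanSpace.single (⟨0, hd⟩ : Fin d) (1 : ℝ) ∈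
        (⊥ : Submodule ℝ (ODPO.Vec d)) := hspan ▸ Submodule.mem_top
    simpa using (Submodule.mem_bot ℝ).mp hv
  obtain ⟨q, -⟩ := Finset.image_nonempty.mp hne
  have : Nonempty (Fin N) := ⟨q.1⟩
  have : Nonempty (Fin K) := ⟨q.2.1⟩
  have ha' : ∀ n k, ‖a n k‖ ≤ 1 := fun n k => mem_closedBall_zero_iff.mp (ha n k)
  have hθ' : ‖θstar‖ ≤ 1 := mem_closedBall_zero_iff.mp hθ
  have htail : ∀ δ : ℝ, 0 < δ → δ < 1 →
      1 - δ ≤ μ.real {ω | ODPO.simpleRegret a θstar (fun n => ahat n ω) ≤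
        30 * Real.sqrt ((d : ℝ) / T) *
          (Real.sqrt (2 * Real.log (1 / δ) +
              d * Real.log ((1 + 4 * (T : ℝ)) / (d : ℝ) ^ (1 - 1 / (d : ℝ)))) +
            1 / Real.sqrt d)} := by
    intro δ hδ hδ1
    refine (hY.one_sub_le_measureReal hlam hδ).trans (measureReal_mono fun ω hω => ?_)
    exact ((hahat ω).simpleRegret_le_noise hd hTpos ha' hspan hθ' (by norm_num) hπstar hπhat
      hpair hlam).trans (ODPO.regret_bound_le hd hT hδ hδ1 hω)
  have hrange : ∀ ω n, ahat n ω ∈ Set.range (a n) := fun ω n => by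
    obtain ⟨_, _, _, _, h⟩ := hahat ω
    exact (h n).1
  have hmeas := ODPO.measurable_simpleRegret a θstar hahat_meas
  have hle2 : ∀ ω, ODPO.simpleRegret a θstar (fun n => ahat n ω) ≤ 2 := fun ω =>
    ODPO.simpleRegret_le_two ha' hθ' (hrange ω)
  have hint : Integrable (fun ω => ODPO.simpleRegret a θstar (fun n => ahat n ω)) μ := by
    refine Integrable.of_bound hmeas.aestronglyMeasurable 2 (ae_of_all _ fun ω => ?_)
    rw [Real.norm_of_nonneg (ODPO.simpleRegret_nonneg (hrange ω))]
    exact hle2 ω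
  refine ⟨htail, hint, ?_⟩
  have hfour := ODPO.four_le_div_rpow hd hT
  rw [add_comm (4 * (T : ℝ)) 1]
  set x := (1 + 4 * (T : ℝ)) / (d : ℝ) ^ (1 - 1 / (d : ℝ)) with hx
  have hx0 : 0 < x := by linarith
  have hδ1 : x⁻¹ < 1 := inv_lt_one_of_one_lt₀ (by linarith)
  have hδd : x⁻¹ ≤ d / (4 * T) := by
    rw [hx, inv_div]
    have := ODPO.rpow_one_sub_inv_le hd
    gcongr
    linarith
  -- The level `δ = 1/x` makes `log (1/δ) = log x`, merging the two logarithms of the tail bound.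
  have h := htail x⁻¹ (inv_pos.mpr hx0) hδ1
  rw [one_div, inv_inv] at h
  exact (ODPO.integral_le_add_mul hmeas hle2 (by norm_num) (by positivity) hint h).trans
    (ODPO.expectation_bound_le hd hT (Real.log_nonneg (by linarith)) hδd)
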